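/- A quantum circuit with fan-out is a sequence of layers. Each layer is a set of gates acting on pairwise disjoint sets of qubits, and each gate is either an arbitrary one-qubit unitary or an unbounded fan-out gate $|y_1\rangle\cdots|y_k\rangle|x\rangle\mapsto|y_1\oplus x\rangle\cdots|y_k\oplus x\rangle|x\rangle$ (for $k=1$ this is the controlled-not gate). The depth of a circuit is its number of layers. The size of a gate is the number of qubits it affects, and the size of a circuit is the total size of its gates. For $x\in\{0,1\}^n$ let $|x|$ denote the Hamming weight. An Or-reduction $n\to m$ with error $\varepsilon$ is a circuit, possibly using ancilla qubits that start in $|0\rangle$ and are returned to $|0\rangle$, which for every $x\in\{0,1\}^n$ maps $|x\rangle|0^m\rangle$ to $|x\rangle|\varphi\rangle$ for some state $|\varphi\rangle$ (depending on $x$) such that $|\varphi\rangle=|0^m\rangle$ if $|x|=0$, and $|\langle 0^m|\varphi\rangle|\le\varepsilon$ if $|x|\neq 0$. Let $\log^{(d)}n$ denote the $d$-times iterated binary logarithm of $n$, with the convention that it is replaced by $1$ whenever it is undefined or less than $1$. **Theorem.** There exist constants $c_1,c_2$ such that for every integer $d\ge 1$ and every integer $n\ge 1$ there is an Or-reduction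 $n\to 1$ with error $\frac1n$, depth at most $c_1 d$, and size at most $c_2\, d\, n\log^{(d)} n$. -/

import Mathlib

/-! ## States and gates -/

namespace FanOutCircuit

/-- State vectors of the qubits in `Q`: amplitudes over the computational basis `Q → Bool`. -/
abbrev State (Q : Type*) : Type _ := (Q → Bool) → ℂ

/-- The all-zero string. -/
def zeros (Q : Type*) : Q → Bool := fun _ => false

/-- The computational basis state `|x⟩`. -/
noncomputable def ket {Q : Type*} (x : Q → Bool) : State Q :=
  open Classical in fun y => if y = x then 1 else 0

/-- A gate: an arbitrary one-qubit unitary applied to the qubit `q`, or an unbounded fan-out gate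
with one control qubit and an arbitrary set of targets (not containing the control). A
controlled-not gate is a fan-out gate with one target. -/
inductive Gate (Q : Type*) where
  | oneQubit (q : Q) (U : Matrix.unitaryGroup Bool ℂ) : Gate Q
  | fanOut (control : Q) (targets : Finset Q) (h : control ∉ targets) : Gate Q

variable {Q : Type*} [DecidableEq Q]

/-- The set of qubits affected by a gate. -/
def Gate.qubits : Gate Q → Finset Q
  | .oneQubit q _ => {q}
  | .fanOut c T _ => insert c T

/-- The size of a gate is the number of affected qubits. -/
def Gate.size (g : Gate Q) : ℕ := g.qubits.card

/-- The classical action of fan-out on bit strings: xor the control bit into every target bit. -/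
def fanOutBits (c : Q) (T : Finset Q) (x : Q → Bool) : Q → Bool :=
  fun q => if q ∈ T then Bool.xor (x q) (x c) else x q

/-- The action of a gate on states. The map `fanOutBits c T` is an involution when `c ∉ T`, so
composing with it sends `|x⟩` to `|fanOutBits c T x⟩`. -/
noncomputable def Gate.apply : Gate Q → State Q → State Q
  | .oneQubit q U, ψ => fun x =>
      ∑ b : Bool, (U : Matrix Bool Bool ℂ) (x q) b * ψ (Function.update x q b)
  | .fanOut c T _, ψ => fun x => ψ (fanOutBits c T x)

/-- The fan-out gate sends the basis state `|x⟩` to the basis state `|fanOutBits c T x⟩`. -/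
theorem Gate.apply_fanOut_ket (c : Q) (T : Finset Q) (h : c ∉ T) (x : Q → Bool) :
    (Gate.fanOut c T h).apply (ket x) = ket (fanOutBits c T x) := by
  have inv : ∀ y : Q → Bool, fanOutBits c T (fanOutBits c T y) = y := by
    intro y
    funext q
    by_cases hq : q ∈ T <;> simp [fanOutBits, hq, h]
  funext y
  have hiff : fanOutBits c T y = x ↔ y = fanOutBits c T x := by
    constructor
    · intro hy
      rw [← hy, inv]
    · intro hy
      rw [hy, inv]
  by_cases hy : y = fanOutBits c T x
  · simp [Gate.apply, ket, hy, inv]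
  · have hy' : fanOutBits c T y ≠ x := fun e => hy (hiff.mp e)
    simp [Gate.apply, ket, hy, hy']

/-! ## Circuits -/

/-- A layer: gates acting on pairwise disjoint sets of qubits. -/
structure Layer (Q : Type*) [DecidableEq Q] where
  gates : List (Gate Q)
  disjoint : gates.Pairwise fun g h => Disjoint g.qubits h.qubits

/-- Apply all gates of a layer (their order does not matter, since they act on disjoint qubits). -/
noncomputable def Layer.apply (L : Layer Q) (ψ : State Q) : State Q :=
  L.gates.foldl (fun φ g => g.apply φ) ψ

/-- The total size of the gates of a layer. -/
def Layer.size (L : Layer Q) : ℕ := (L.gates.map Gate.size).sum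

/-- A quantum circuit with fan-out: a sequence of layers. -/
abbrev Circuit (Q : Type*) [DecidableEq Q] : Type _ := List (Layer Q)

/-- Apply the layers of a circuit one after the other. -/
noncomputable def Circuit.apply (C : Circuit Q) (ψ : State Q) : State Q :=
  C.foldl (fun φ L => L.apply φ) ψ

/-- The depth of a circuit is the number of its layers. -/
def Circuit.depth (C : Circuit Q) : ℕ := C.length

/-- The size of a circuit is the total size of all its gates. -/
def Circuit.size (C : Circuit Q) : ℕ := (C.map Layer.size).sum

/-! ## Or-reductions -/

/-- The product state `|ψ₁⟩ |ψ₂⟩ |ψ₃⟩` on three registers. -/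
def tensor₃ {A B D : Type*} (ψ₁ : State A) (ψ₂ : State B) (ψ₃ : State D) : State (A ⊕ B ⊕ D) :=
  fun z => ψ₁ (fun i => z (.inl i)) * ψ₂ (fun j => z (.inr (.inl j))) *
    ψ₃ (fun k => z (.inr (.inr k)))

/-- The Hamming weight `|x|`. -/
def hammingWeight {n : ℕ} (x : Fin n → Bool) : ℕ :=
  (Finset.univ.filter fun i => x i = true).card

/-- `C` is an Or-reduction `n → m` with error `ε`, using `a` ancilla qubits that start in `|0⟩`
and are cleaned at the end: for every `x ∈ {0,1}ⁿ`, `C` maps `|x⟩ |0ᵐ⟩ |0ᵃ⟩` to `|x⟩ |φ⟩ |0ᵃ⟩`,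
where `|φ⟩ = |0ᵐ⟩` if `|x| = 0`, and `|⟨0ᵐ|φ⟩| ≤ ε` if `|x| ≠ 0`. -/
def IsOrReduction {n m a : ℕ} (ε : ℝ) (C : Circuit (Fin n ⊕ Fin m ⊕ Fin a)) : Prop :=
  ∀ x : Fin n → Bool, ∃ φ : State (Fin m),
    C.apply (tensor₃ (ket x) (ket (zeros (Fin m))) (ket (zeros (Fin a)))) =
      tensor₃ (ket x) φ (ket (zeros (Fin a))) ∧
    (hammingWeight x = 0 → φ = ket (zeros (Fin m))) ∧
    (hammingWeight x ≠ 0 → ‖φ (zeros (Fin m))‖ ≤ ε)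

/-! ## The iterated logarithm -/

/-- The `d`-times iterated binary logarithm of `x`, truncated below at `1`: its value is
`max 1 (log log ⋯ log x)` when the `d`-fold iterated logarithm exists, and `1` otherwise. -/
noncomputable def ilog : ℕ → ℝ → ℝ
  | 0, x => x
  | d + 1, x => max 1 (Real.logb 2 (ilog d x))

/-- As long as the iterated logarithms are at least `1`, `ilog` is the plain iterate of `log₂`. -/
theorem ilog_eq_iterate (d : ℕ) (x : ℝ) (h : ∀ j ≤ d, 1 ≤ (Real.logb 2)^[j] x) :
    ilog d x = (Real.logb 2)^[d] x := by
  induction d with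
  | zero => rfl
  | succ d ih =>
    have h1 := h (d + 1) le_rfl
    rw [Function.iterate_succ_apply'] at h1 ⊢
    rw [ilog, ih fun j hj => h j (by omega)]
    exact max_eq_right h1

end FanOutCircuit

/-! The disjunction is computed exactly. A controlled rotation is diagonal after conjugation by
Hadamard gates, and a fan-out conjugated by Hadamard gates computes parities; phases by parities are
therefore available in constant depth. Since the product of the phases `exp (2πi / 2 ^ m)` over all
subsets of odd parity of `m` bits is `-1` unless all bits vanish, the disjunction of `m` bits has
constant depth and size `O(m 2 ^ m)`. For a block of fewer than `2 ^ m` bits of weight `w`, the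
phases `exp (2πi w / 2 ^ (i + 1))`, `i < m`, are all `1` if `w = 0`, and one of them is `-1`
otherwise, so `m` rotated qubits followed by a disjunction of `m` bits compute the disjunction of
the block. Blocks of length about `log^(d) n` cost `O(n log^(d + 1) n)` in total and leave
`O(n / log^(d) n)` bits, whose disjunction is computed with `d` levels in size `O(d n)`. -/

namespace FanOutCircuit

open Function Matrix

/-! ## Relabelling the qubits of a circuit -/

section Relabelling

theorem extend_eq_of_comp_eq {α β γ : Type*} {e : α → β} (he : Injective e) {y : α → γ}
    {z w : β → γ} (hw : w ∘ e = y) (hz : ∀ b ∉ Set.range e, w b = z b) : extend e y z = w := by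
  subst hw
  funext b
  by_cases hb : b ∈ Set.range e
  · obtain ⟨a, rfl⟩ := hb
    exact he.extend_apply _ _ a
  · rw [extend_apply' _ _ _ hb, hz b hb]

theorem extend_comp_self {α β γ : Type*} {e : α → β} (he : Injective e) (z : β → γ) :
    extend e (z ∘ e) z = z :=
  extend_eq_of_comp_eq he rfl fun _ _ => rfl

theorem extend_sumMap {α α' β β' γ : Type*} {e : α → β} {i : α' → β'} (he : Injective e)
    (hi : Injective i) (y : α ⊕ α' → γ) (z : β ⊕ β' → γ) :
    extend (Sum.map e i) y z =
      Sum.elim (extend e (y ∘ Sum.inl) (z ∘ Sum.inl)) (extend i (y ∘ Sum.inr) (z ∘ Sum.inr)) := by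
  refine extend_eq_of_comp_eq (he.sumMap hi) (funext ?_) ?_
  · rintro (a | a)
    · exact he.extend_apply _ _ a
    · exact hi.extend_apply _ _ a
  · rintro (b | b) hb
    · exact extend_apply' _ _ _ fun ⟨a, ha⟩ => hb ⟨Sum.inl a, congrArg Sum.inl ha⟩
    · exact extend_apply' _ _ _ fun ⟨a, ha⟩ => hb ⟨Sum.inr a, congrArg Sum.inr ha⟩

variable {Q Q' : Type*}

/-- The restriction of a state to the strings that agree with `z` off the range of `e`. -/
noncomputable def slice (e : Q ↪ Q') (z : Q' → Bool) (ψ : State Q') : State Q :=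
  fun y => ψ (extend e y z)

/-- The operator acting as `V` on the qubits in the range of `e` and trivially on the others. -/
noncomputable def lift (e : Q ↪ Q') (V : State Q → State Q) (ψ : State Q') : State Q' :=
  fun z => V (slice e z ψ) (z ∘ e)

theorem slice_lift (e : Q ↪ Q') (V : State Q → State Q) (z : Q' → Bool) (ψ : State Q') :
    slice e z (lift e V ψ) = V (slice e z ψ) := by
  funext y
  have hcomp : extend e y z ∘ e = y := funext (e.injective.extend_apply y z)
  have hext (w : Q → Bool) : extend e w (extend e y z) = extend e w z :=
    extend_eq_of_comp_eq e.injective (funext (e.injective.extend_apply w z)) fun b hb => by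
      rw [extend_apply' _ _ _ hb, extend_apply' _ _ _ hb]
  have hslice : slice e (extend e y z) ψ = slice e z ψ := funext fun w => congrArg ψ (hext w)
  simp only [slice.eq_def e z (lift e V ψ), lift, hcomp, hslice]

theorem eq_of_slice_eq (e : Q ↪ Q') {ψ φ : State Q'} (h : ∀ z, slice e z ψ = slice e z φ) :
    ψ = φ := by
  funext z
  simpa only [slice, extend_comp_self e.injective] using congrFun (h z) (z ∘ e)

theorem lift_lift (e : Q ↪ Q') (V W : State Q → State Q) (ψ : State Q') :
    lift e V (lift e W ψ) = lift e (V ∘ W) ψ :=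
  eq_of_slice_eq e fun z => by simp only [slice_lift, Function.comp_apply]

theorem lift_id (e : Q ↪ Q') : lift e id = id :=
  funext fun _ => eq_of_slice_eq e fun z => slice_lift e id z _

theorem lift_equiv (σ : Q ≃ Q') (V : State Q → State Q) (ψ : State Q') :
    lift σ.toEmbedding V ψ = fun z => V (fun y => ψ (y ∘ σ.symm)) (z ∘ σ) := by
  have hext (y : Q → Bool) (z : Q' → Bool) : extend σ y z = y ∘ σ.symm :=
    extend_eq_of_comp_eq σ.injective (by ext; simp) fun b hb => absurd (σ.surjective b) hb
  funext z
  exact congrArg (V · (z ∘ σ)) (funext fun y => congrArg ψ (hext y z))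

variable [DecidableEq Q] [DecidableEq Q']

/-- Relabel the qubits of a gate along an embedding. -/
def Gate.map (e : Q ↪ Q') : Gate Q → Gate Q'
  | .oneQubit q U => .oneQubit (e q) U
  | .fanOut c T h => .fanOut (e c) (T.map e) (by simpa using h)

theorem Gate.qubits_map (e : Q ↪ Q') (g : Gate Q) : (g.map e).qubits = g.qubits.map e := by
  cases g <;> simp [Gate.map, Gate.qubits, Finset.map_insert]

/-- Relabel the qubits of a layer along an embedding. -/
def Layer.map (e : Q ↪ Q') (L : Layer Q) : Layer Q' where
  gates := L.gates.map (Gate.map e)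
  disjoint := by
    rw [List.pairwise_map]
    refine L.disjoint.imp fun {g h} hd => ?_
    rw [Gate.qubits_map, Gate.qubits_map]
    exact (Finset.disjoint_map e).2 hd

theorem Layer.size_map (e : Q ↪ Q') (L : Layer Q) : (L.map e).size = L.size := by
  have hsize : Gate.size ∘ Gate.map e = Gate.size := funext fun g => by
    rw [Function.comp_apply, Gate.size, Gate.qubits_map, Finset.card_map, Gate.size]
  rw [Layer.size, Layer.map, List.map_map, hsize, Layer.size]

/-- Relabel the qubits of a circuit along an embedding. -/
def Circuit.map (e : Q ↪ Q') (C : Circuit Q) : Circuit Q' := List.map (Layer.map e) C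

theorem Circuit.depth_map (e : Q ↪ Q') (C : Circuit Q) :
    Circuit.depth (Circuit.map e C) = Circuit.depth C :=
  List.length_map _

theorem Circuit.size_map (e : Q ↪ Q') (C : Circuit Q) :
    Circuit.size (Circuit.map e C) = Circuit.size C := by
  simp [Circuit.size, Circuit.map, comp_def, Layer.size_map]

theorem extend_update (e : Q ↪ Q') (y : Q → Bool) (z : Q' → Bool) (q : Q) (b : Bool) :
    extend e (update y q b) z = update (extend e y z) (e q) b := by
  refine extend_eq_of_comp_eq e.injective (funext fun a => ?_) fun r hr => ?_
  · by_cases ha : a = q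
    · simp [ha]
    · simp [ha, e.injective.extend_apply]
  · rw [update_of_ne (fun h => hr ⟨q, h.symm⟩), extend_apply' _ _ _ hr]

theorem extend_fanOutBits (e : Q ↪ Q') (y : Q → Bool) (z : Q' → Bool) (c : Q) (T : Finset Q) :
    extend e (fanOutBits c T y) z = fanOutBits (e c) (T.map e) (extend e y z) := by
  refine extend_eq_of_comp_eq e.injective (funext fun a => ?_) fun r hr => ?_
  · simp [fanOutBits, e.injective.extend_apply]
  · have hrT : r ∉ T.map e := fun h => by
      obtain ⟨a, -, ha⟩ := Finset.mem_map.1 h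
      exact hr ⟨a, ha⟩
    rw [fanOutBits, if_neg hrT, extend_apply' _ _ _ hr]

theorem Gate.slice_apply_map (e : Q ↪ Q') (z : Q' → Bool) (g : Gate Q) (ψ : State Q') :
    slice e z ((g.map e).apply ψ) = g.apply (slice e z ψ) := by
  funext y
  cases g with
  | oneQubit q U =>
    simp only [slice, Gate.map, Gate.apply, extend_update, e.injective.extend_apply]
  | fanOut c T h => simp only [slice, Gate.map, Gate.apply, extend_fanOutBits]

theorem Layer.slice_apply_map (e : Q ↪ Q') (z : Q' → Bool) (L : Layer Q) (ψ : State Q') :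
    slice e z ((L.map e).apply ψ) = L.apply (slice e z ψ) := by
  simp only [Layer.apply, Layer.map]
  induction L.gates generalizing ψ with
  | nil => rfl
  | cons g gs ih => simp only [List.map_cons, List.foldl_cons, ih, Gate.slice_apply_map]

theorem Circuit.slice_apply_map (e : Q ↪ Q') (z : Q' → Bool) (C : Circuit Q) (ψ : State Q') :
    slice e z (Circuit.apply (Circuit.map e C) ψ) = Circuit.apply C (slice e z ψ) := by
  simp only [Circuit.apply, Circuit.map]
  induction C generalizing ψ with
  | nil => rfl
  | cons L C ih => simp only [List.map_cons, List.foldl_cons, ih, Layer.slice_apply_map]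

theorem Circuit.apply_map (e : Q ↪ Q') (C : Circuit Q) :
    Circuit.apply (Circuit.map e C) = lift e (Circuit.apply C) :=
  funext fun _ => eq_of_slice_eq e fun z => by rw [Circuit.slice_apply_map, slice_lift]

theorem Gate.apply_smul (g : Gate Q) (c : ℂ) (ψ : State Q) :
    g.apply (c • ψ) = c • g.apply ψ := by
  cases g with
  | oneQubit q U =>
    funext y
    simp only [Gate.apply, Pi.smul_apply, smul_eq_mul, Finset.mul_sum, mul_left_comm]
  | fanOut => rfl

theorem Layer.apply_smul (L : Layer Q) (c : ℂ) (ψ : State Q) :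
    L.apply (c • ψ) = c • L.apply ψ := by
  simp only [Layer.apply]
  induction L.gates generalizing ψ with
  | nil => rfl
  | cons g gs ih => simp only [List.foldl_cons, Gate.apply_smul, ih]

theorem Circuit.apply_smul (C : Circuit Q) (c : ℂ) (ψ : State Q) :
    Circuit.apply C (c • ψ) = c • Circuit.apply C ψ := by
  simp only [Circuit.apply]
  induction C generalizing ψ with
  | nil => rfl
  | cons L C ih => simp only [List.foldl_cons, Layer.apply_smul, ih]

theorem Circuit.apply_append (C D : Circuit Q) (ψ : State Q) :
    Circuit.apply (C ++ D) ψ = Circuit.apply D (Circuit.apply C ψ) :=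
  List.foldl_append

theorem Circuit.depth_append (C D : Circuit Q) :
    Circuit.depth (C ++ D) = Circuit.depth C + Circuit.depth D :=
  List.length_append

theorem Circuit.size_append (C D : Circuit Q) :
    Circuit.size (C ++ D) = Circuit.size C + Circuit.size D := by
  rw [Circuit.size, List.map_append, List.sum_append, Circuit.size, Circuit.size]

end Relabelling

/-! ## Operators realized with clean ancillas -/

section Ancillas

variable {Q Q' A A' B : Type*}

/-- The state `ψ ⊗ |0⟩` on the qubits `Q` and the ancillas `A`. -/
noncomputable def padZero (ψ : State Q) : State (Q ⊕ A) :=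
  fun z => ψ (z ∘ Sum.inl) * ket (zeros A) (z ∘ Sum.inr)

theorem ket_self (x : Q → Bool) : ket x x = 1 :=
  if_pos rfl

theorem ket_of_ne {x y : Q → Bool} (h : y ≠ x) : ket x y = 0 :=
  if_neg h

theorem ket_zeros_extend (i : A ↪ A') (y : A → Bool) (z : A' → Bool) :
    ket (zeros A') (extend i y z) =
      ket (zeros A) y * ket (zeros A') (extend i (zeros A) z) := by
  by_cases hy : y = zeros A
  · rw [hy, ket_self, one_mul]
  · have hne : extend i y z ≠ zeros A' := fun h => hy <| funext fun a =>
      (i.injective.extend_apply y z a).symm.trans (congrFun h (i a))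
    rw [ket_of_ne hy, ket_of_ne hne, zero_mul]

theorem ket_sumElim (x : A → Bool) (y : B → Bool) (z : A ⊕ B → Bool) :
    ket (Sum.elim x y) z = ket x (z ∘ Sum.inl) * ket y (z ∘ Sum.inr) := by
  have hiff : z = Sum.elim x y ↔ z ∘ Sum.inl = x ∧ z ∘ Sum.inr = y := by
    simp [funext_iff]
  unfold ket
  split_ifs <;> simp_all

theorem slice_padZero (e : Q ↪ Q') (i : A ↪ A') (z : Q' ⊕ A' → Bool) (ψ : State Q') :
    slice (e.sumMap i) z (padZero ψ) =
      ket (zeros A') (extend i (zeros A) (z ∘ Sum.inr)) • padZero (slice e (z ∘ Sum.inl) ψ) := by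
  funext y
  simp only [slice, padZero, Pi.smul_apply, smul_eq_mul, Embedding.coe_sumMap,
    extend_sumMap e.injective i.injective, Sum.elim_comp_inl, Sum.elim_comp_inr]
  rw [ket_zeros_extend]
  ring

variable [DecidableEq Q] [DecidableEq Q'] [DecidableEq A] [DecidableEq A']

theorem Circuit.apply_map_padZero (e : Q ↪ Q') (i : A ↪ A') {C : Circuit (Q ⊕ A)}
    {V : State Q → State Q} (hC : ∀ ψ, Circuit.apply C (padZero ψ) = padZero (V ψ))
    (ψ : State Q') :
    Circuit.apply (Circuit.map (e.sumMap i) C) (padZero ψ) = padZero (lift e V ψ) :=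
  eq_of_slice_eq (e.sumMap i) fun z => by
    rw [Circuit.slice_apply_map, slice_padZero, slice_padZero, Circuit.apply_smul, hC, slice_lift]

/-- `V` is realized, with ancillas that start and end in `|0⟩`, by a circuit of depth at most `D`
and size at most `S`. -/
def Realizable (V : State Q → State Q) (D : ℕ) (S : ℝ) : Prop :=
  ∃ (A : Type) (_ : Fintype A) (_ : DecidableEq A) (C : Circuit (Q ⊕ A)),
    (∀ ψ, Circuit.apply C (padZero ψ) = padZero (V ψ)) ∧ Circuit.depth C ≤ D ∧
      (Circuit.size C : ℝ) ≤ S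

namespace Realizable

variable {V W : State Q → State Q} {D D' : ℕ} {S S' : ℝ}

theorem mono (h : Realizable V D S) (hD : D ≤ D') (hS : S ≤ S') : Realizable V D' S' := by
  obtain ⟨A, _, _, C, hC, hCD, hCS⟩ := h
  exact ⟨A, ‹_›, ‹_›, C, hC, hCD.trans hD, hCS.trans hS⟩

theorem lift (h : Realizable V D S) (e : Q ↪ Q') : Realizable (lift e V) D S := by
  obtain ⟨A, _, _, C, hC, hCD, hCS⟩ := h
  refine ⟨A, ‹_›, ‹_›, Circuit.map (e.sumMap (Embedding.refl A)) C,
    Circuit.apply_map_padZero e _ hC, ?_, ?_⟩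
  · rwa [Circuit.depth_map]
  · rwa [Circuit.size_map]

theorem comp (hV : Realizable V D S) (hW : Realizable W D' S') :
    Realizable (W ∘ V) (D + D') (S + S') := by
  obtain ⟨A, _, _, C, hC, hCD, hCS⟩ := hV
  obtain ⟨B, _, _, C', hC', hCD', hCS'⟩ := hW
  have hC₁ := Circuit.apply_map_padZero (Embedding.refl Q) (Embedding.inl (β := B)) hC
  have hC₂ := Circuit.apply_map_padZero (Embedding.refl Q) (Embedding.inr (α := A)) hC'
  have hrefl (V : State Q → State Q) : FanOutCircuit.lift (Embedding.refl Q) V = V :=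
    funext fun ψ => lift_equiv (Equiv.refl Q) V ψ
  refine ⟨A ⊕ B, inferInstance, inferInstance,
    Circuit.map ((Embedding.refl Q).sumMap Embedding.inl) C ++
      Circuit.map ((Embedding.refl Q).sumMap Embedding.inr) C', fun ψ => ?_, ?_, ?_⟩
  · rw [Circuit.apply_append, hC₁, hC₂, hrefl, hrefl, Function.comp_apply]
  · rw [Circuit.depth_append, Circuit.depth_map, Circuit.depth_map]
    exact Nat.add_le_add hCD hCD'
  · rw [Circuit.size_append, Circuit.size_map, Circuit.size_map, Nat.cast_add]
    exact add_le_add hCS hCS'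

theorem of_padZero {A : Type} [Finite A] [DecidableEq A]
    {W : State (Q ⊕ A) → State (Q ⊕ A)} (hW : Realizable W D S)
    (hWV : ∀ ψ, W (padZero ψ) = padZero (V ψ)) : Realizable V D S := by
  cases nonempty_fintype A
  obtain ⟨B, _, _, C, hC, hCD, hCS⟩ := hW
  let σ := Equiv.sumAssoc Q A B
  have hassoc (φ : State Q) (z : Q ⊕ A ⊕ B → Bool) :
      padZero (padZero φ) (z ∘ σ) = padZero φ z := by
    have hzeros : zeros (A ⊕ B) = Sum.elim (zeros A) (zeros B) := (Sum.elim_const_const _).symm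
    simp only [padZero, hzeros, ket_sumElim, mul_assoc]
    rfl
  have hassoc' (φ : State Q) :
      (fun z => padZero φ (z ∘ σ.symm)) = padZero (A := B) (padZero (A := A) φ) :=
    funext fun z => (hassoc φ _).symm
  refine ⟨A ⊕ B, inferInstance, inferInstance,
    Circuit.map σ.toEmbedding C, fun ψ => ?_, ?_, ?_⟩
  · rw [Circuit.apply_map, lift_equiv, hassoc', hC, hWV]
    exact funext (hassoc _)
  · rwa [Circuit.depth_map]
  · rwa [Circuit.size_map]

end Realizable

end Ancillas

/-! ## Tensor products of one-qubit operators -/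

section TensorProducts

variable {A X : Type*}

/-- The character `b ↦ (-1)ᵇ` of `Bool`, regarded as the field with two elements. -/
def sign : AddChar Bool ℂ where
  toFun b := if b then -1 else 1
  map_zero_eq_one' := by simp
  map_add_eq_mul' a b := by cases a <;> cases b <;> simp [Bool.add_eq_xor]

theorem sign_true : sign true = -1 := rfl

theorem sign_false : sign false = 1 := rfl

theorem sign_mul_self (b : Bool) : sign b * sign b = 1 := by
  rw [← AddChar.map_add_eq_mul, BooleanRing.add_self, AddChar.map_zero_eq_one]

theorem sign_sum (s : Finset A) (f : A → Bool) : sign (∑ a ∈ s, f a) = ∏ a ∈ s, sign (f a) :=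
  map_prod sign.toMonoidHom (fun a => Multiplicative.ofAdd (f a)) s

/-- The tensor product of a family of matrices, with rows and columns indexed by tuples. -/
def tensorMatrix {R l m : Type*} [CommSemiring R] [Fintype A] (M : A → Matrix l m R) :
    Matrix (A → l) (A → m) R :=
  of fun z w => ∏ a, M a (z a) (w a)

theorem tensorMatrix_mul {R l m n : Type*} [CommSemiring R] [Fintype A] [DecidableEq A]
    [Fintype m] (M : A → Matrix l m R) (N : A → Matrix m n R) :
    tensorMatrix M * tensorMatrix N = tensorMatrix fun a => M a * N a := by
  ext z w
  simp only [tensorMatrix, mul_apply, of_apply, ← Finset.prod_mul_distrib, Finset.prod_univ_sum,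
    Fintype.piFinset_univ]

theorem tensorMatrix_diagonal {R m : Type*} [CommSemiring R] [Fintype A] [DecidableEq m]
    (D : A → m → R) :
    tensorMatrix (fun a => diagonal (D a)) = diagonal fun z : A → m => ∏ a, D a (z a) := by
  ext z w
  by_cases h : z = w
  · simp [tensorMatrix, h]
  · obtain ⟨a, ha⟩ := Function.ne_iff.1 h
    rw [diagonal_apply_ne _ h]
    exact Finset.prod_eq_zero (Finset.mem_univ a) (diagonal_apply_ne _ ha)

theorem tensorMatrix_one {R m : Type*} [CommSemiring R] [Fintype A] [DecidableEq m] :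
    tensorMatrix (fun _ : A => (1 : Matrix m m R)) = 1 := by
  simp only [← diagonal_one, tensorMatrix_diagonal, Finset.prod_const_one]

/-- The operator `|x⟩|ψ⟩ ↦ |x⟩ (M x)|ψ⟩` on the registers `X` and `A`. -/
noncomputable def controlled [Fintype A] [DecidableEq A]
    (M : (X → Bool) → Matrix (A → Bool) (A → Bool) ℂ) (ψ : State (X ⊕ A)) : State (X ⊕ A) :=
  fun z => (M (z ∘ Sum.inl) *ᵥ fun w => ψ (Sum.elim (z ∘ Sum.inl) w)) (z ∘ Sum.inr)

theorem controlled_controlled [Fintype A] [DecidableEq A]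
    (M N : (X → Bool) → Matrix (A → Bool) (A → Bool) ℂ) (ψ : State (X ⊕ A)) :
    controlled M (controlled N ψ) = controlled (fun x => M x * N x) ψ := by
  funext z
  simp only [controlled, ← mulVec_mulVec, Sum.elim_comp_inl, Sum.elim_comp_inr]

theorem controlled_one [Fintype A] [DecidableEq A] :
    controlled (fun _ : X → Bool => (1 : Matrix (A → Bool) (A → Bool) ℂ)) = id := by
  funext ψ z
  simp only [controlled, one_mulVec, Sum.elim_comp_inl_inr, id]

/-- The Hadamard matrix. -/
noncomputable def hadamardGate : Matrix Bool Bool ℂ :=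
  of fun b c => sign (b * c) / (√2 : ℝ)

theorem hadamardGate_apply_mul_apply (a b c d : Bool) :
    hadamardGate a b * hadamardGate c d = sign (a * b + c * d) / 2 := by
  rw [hadamardGate, of_apply, of_apply, div_mul_div_comm, ← AddChar.map_add_eq_mul,
    ← Complex.ofReal_mul, Real.mul_self_sqrt zero_le_two, Complex.ofReal_ofNat]

theorem hadamardGate_mul_self : hadamardGate * hadamardGate = 1 := by
  ext b c
  rw [mul_apply, Fintype.sum_bool, hadamardGate_apply_mul_apply, hadamardGate_apply_mul_apply]
  cases b <;> cases c <;>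
    simp [Bool.mul_eq_and, Bool.add_eq_xor, sign_true, sign_false] <;> norm_num

theorem hadamardGate_mem_unitaryGroup : hadamardGate ∈ Matrix.unitaryGroup Bool ℂ := by
  have hstar : star hadamardGate = hadamardGate := by
    ext b c
    cases b <;> cases c <;> simp [hadamardGate, star_apply, Bool.mul_eq_and, sign_true, sign_false]
  rw [mem_unitaryGroup_iff, hstar, hadamardGate_mul_self]

theorem tensorMatrix_hadamardGate_apply [Fintype A] (z w : A → Bool) :
    tensorMatrix (fun _ : A => hadamardGate) z w =
      sign (z ⬝ᵥ w) / ((√2 : ℝ) : ℂ) ^ Fintype.card A := by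
  simp only [tensorMatrix, hadamardGate, of_apply, Finset.prod_div_distrib, dotProduct, sign_sum,
    Finset.prod_const, Finset.card_univ]

/-- Conjugation by Hadamard gates turns a linear map of bit strings into its transpose. -/
theorem tensorMatrix_hadamardGate_mulVec_comp [Fintype A] [DecidableEq A]
    {F F' : (A → Bool) → (A → Bool)} (hF : Involutive F)
    (hadj : ∀ z w, F z ⬝ᵥ w = z ⬝ᵥ F' w) (ψ : State A) :
    tensorMatrix (fun _ : A => hadamardGate) *ᵥ (ψ ∘ F) =
      (tensorMatrix (fun _ : A => hadamardGate) *ᵥ ψ) ∘ F' := by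
  funext z
  refine Fintype.sum_equiv hF.toPerm _ _ fun w => ?_
  have hdot : F' z ⬝ᵥ F w = z ⬝ᵥ w := by rw [dotProduct_comm, ← hadj, hF, dotProduct_comm]
  simp only [hF.coe_toPerm, Function.comp_apply, tensorMatrix_hadamardGate_apply, hdot]

/-- The function on bits with value `u` at `1` and value `1` at `0`. -/
def phase (u : ℂ) (b : Bool) : ℂ := if b then u else 1

theorem phase_mul (u v : ℂ) (b : Bool) : phase (u * v) b = phase u b * phase v b := by
  cases b <;> simp [phase]

theorem phase_sq_mul {u : ℂ} (hu : u ≠ 0) (a b : Bool) :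
    phase (u ^ 2) (a * b) = phase u a * phase u b * phase u⁻¹ (a + b) := by
  cases a <;> cases b <;> simp [phase, Bool.add_eq_xor, Bool.mul_eq_and, hu, sq]

theorem diagonal_phase_mem_unitaryGroup {u : ℂ} (hu : ‖u‖ = 1) :
    diagonal (phase u) ∈ Matrix.unitaryGroup Bool ℂ := by
  have hphase (b : Bool) : phase u b * star (phase u b) = 1 := by
    cases b <;> simp [phase, Complex.mul_conj', hu]
  rw [mem_unitaryGroup_iff, star_eq_conjTranspose, diagonal_conjTranspose, diagonal_mul_diagonal]
  simp only [Pi.star_apply, hphase, diagonal_one]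

/-- The conjugate of the phase gate `diag (1, u)` by the Hadamard gate. -/
noncomputable def rot (u : ℂ) : Matrix Bool Bool ℂ :=
  hadamardGate * diagonal (phase u) * hadamardGate

theorem rot_mul (u v : ℂ) : rot u * rot v = rot (u * v) := by
  have hdiag : diagonal (phase u) * diagonal (phase v) = diagonal (phase (u * v)) := by
    rw [diagonal_mul_diagonal, funext (phase_mul u v)]
  calc rot u * rot v
      = hadamardGate * diagonal (phase u) * (hadamardGate * hadamardGate) *
          diagonal (phase v) * hadamardGate := by
        simp only [rot, Matrix.mul_assoc]
    _ = rot (u * v) := by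
        rw [hadamardGate_mul_self, Matrix.mul_one, Matrix.mul_assoc hadamardGate, hdiag, rot]

theorem rot_apply (u : ℂ) (b c : Bool) : rot u b c = (1 + sign (b + c) * u) / 2 := by
  rw [rot, mul_apply, Fintype.sum_bool, mul_diagonal, mul_diagonal,
    mul_right_comm, hadamardGate_apply_mul_apply, mul_right_comm, hadamardGate_apply_mul_apply]
  cases b <;> cases c <;>
    simp [phase, Bool.mul_eq_and, Bool.add_eq_xor, sign_true, sign_false] <;> ring

theorem rot_one : rot 1 = 1 := by
  have hphase : phase 1 = fun _ => 1 := funext fun b => by simp [phase]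
  rw [rot, hphase, diagonal_one, Matrix.mul_one, hadamardGate_mul_self]

theorem rot_sign (a b c : Bool) : rot (sign a) b c = if c = b + a then 1 else 0 := by
  rw [rot_apply]
  cases a <;> cases b <;> cases c <;> simp [Bool.add_eq_xor, sign_true, sign_false]

theorem rot_sign_ne_zero_iff {a b : Bool} : rot (sign a) b false ≠ 0 ↔ b = a := by
  rw [rot_sign, ne_eq, ite_eq_right_iff, Classical.not_imp, ← BooleanRing.add_eq_zero' b a]
  exact (and_iff_left one_ne_zero).trans eq_comm

end TensorProducts

/-! ## Oracles and rotations -/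

section Operators

variable {A X Y Q : Type*}

/-- The bijection `(x, y) ↦ (x, y ⊕ f x)` of bit strings. -/
def xorInto (f : (X → Bool) → (Y → Bool)) (z : X ⊕ Y → Bool) : X ⊕ Y → Bool :=
  Sum.elim (z ∘ Sum.inl) (z ∘ Sum.inr + f (z ∘ Sum.inl))

theorem xorInto_involutive (f : (X → Bool) → (Y → Bool)) : Involutive (xorInto f) := fun z => by
  have hcancel : z ∘ Sum.inr + f (z ∘ Sum.inl) + f (z ∘ Sum.inl) = z ∘ Sum.inr := by
    ext y
    simp only [Pi.add_apply, add_assoc, BooleanRing.add_self, add_zero]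
  rw [xorInto, xorInto, Sum.elim_comp_inl, Sum.elim_comp_inr, hcancel, Sum.elim_comp_inl_inr]

/-- The oracle `|x⟩|y⟩ ↦ |x⟩|y ⊕ f x⟩` for the bit function `f`. -/
def oracle (f : (X → Bool) → (Y → Bool)) (ψ : State (X ⊕ Y)) : State (X ⊕ Y) :=
  ψ ∘ xorInto f

/-- The diagonal operator `|z⟩ ↦ p(z)|z⟩`. -/
def phaseOp (p : (Q → Bool) → ℂ) (ψ : State Q) : State Q :=
  fun z => p z * ψ z

/-- On the `a`-th qubit of the register `A`, the rotation `rot (e x a)` controlled by the bit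
string `x` in the register `X`. -/
noncomputable def rotation [Fintype A] [DecidableEq A] (e : (X → Bool) → (A → ℂ)) :
    State (X ⊕ A) → State (X ⊕ A) :=
  controlled fun x => tensorMatrix fun a => rot (e x a)

theorem rotation_comp_rotation [Fintype A] [DecidableEq A] (e e' : (X → Bool) → (A → ℂ)) :
    rotation e ∘ rotation e' = rotation (e * e') := by
  funext ψ
  simp only [rotation, Function.comp_apply, controlled_controlled, tensorMatrix_mul, rot_mul,
    Pi.mul_apply]

theorem rotation_one [Fintype A] [DecidableEq A] :
    rotation (1 : (X → Bool) → (A → ℂ)) = id := by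
  simp only [rotation, Pi.one_apply, rot_one, tensorMatrix_one, controlled_one]

theorem rotation_sign [Fintype A] [DecidableEq A] (f : (X → Bool) → (A → Bool)) :
    rotation (fun x a => sign (f x a)) = oracle f := by
  have htensor (x : X → Bool) (z w : A → Bool) :
      tensorMatrix (fun a => rot (sign (f x a))) z w = if w = z + f x then 1 else 0 := by
    simp only [tensorMatrix, of_apply, rot_sign, Finset.prod_ite_zero, Finset.prod_const_one,
      Finset.mem_univ, true_imp_iff, funext_iff, Pi.add_apply]
  funext ψ z
  simp only [rotation, controlled, mulVec, dotProduct, htensor, ite_mul, one_mul, zero_mul,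
    Fintype.sum_ite_eq']
  rfl

theorem lift_inr (V : State A → State A) (ψ : State (X ⊕ A)) :
    lift Embedding.inr V ψ = fun z => V (fun w => ψ (Sum.elim (z ∘ Sum.inl) w)) (z ∘ Sum.inr) := by
  have hext (z : X ⊕ A → Bool) (w : A → Bool) :
      extend (Embedding.inr (α := X)) w z = Sum.elim (z ∘ Sum.inl) w :=
    extend_eq_of_comp_eq Sum.inr_injective rfl fun b hb => by
      rcases b with x | a
      · rfl
      · exact absurd ⟨a, rfl⟩ hb
  funext z
  exact congrArg (V · (z ∘ Sum.inr)) (funext fun w => congrArg ψ (hext z w))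

theorem rotation_eq_hadamardGate_comp [Fintype A] [DecidableEq A] (e : (X → Bool) → (A → ℂ)) :
    rotation e =
      lift Embedding.inr (tensorMatrix (fun _ : A => hadamardGate) *ᵥ ·) ∘
        phaseOp (fun z => ∏ a, phase (e (z ∘ Sum.inl) a) (z (Sum.inr a))) ∘
          lift Embedding.inr (tensorMatrix (fun _ : A => hadamardGate) *ᵥ ·) := by
  funext ψ z
  simp only [rotation, controlled, rot, ← tensorMatrix_mul, tensorMatrix_diagonal,
    ← mulVec_mulVec, Function.comp_apply, lift_inr, phaseOp, Sum.elim_comp_inl,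
    Sum.elim_comp_inr, Sum.elim_inr]
  congr 2
  funext w
  rw [mulVec_diagonal]

end Operators

/-! ## Single layers -/

section Layers

variable {Q C T : Type*} [DecidableEq Q] [DecidableEq C] [DecidableEq T]

theorem Layer.size_le_card [Fintype Q] (L : Layer Q) : L.size ≤ Fintype.card Q := by
  have hnodup : (L.gates.flatMap fun g => g.qubits.toList).Nodup :=
    List.nodup_flatMap.2 ⟨fun g _ => g.qubits.nodup_toList, L.disjoint.imp fun h q hg hh =>
      Finset.disjoint_left.1 h (Finset.mem_toList.1 hg) (Finset.mem_toList.1 hh)⟩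
  calc L.size = (L.gates.flatMap fun g => g.qubits.toList).length := by
        simp only [List.length_flatMap, Finset.length_toList]; rfl
    _ ≤ Fintype.card Q := hnodup.length_le_card

omit [DecidableEq Q] in
theorem slice_inl_padZero {A : Type*} (z : Q ⊕ A → Bool) (ψ : State Q) :
    slice Embedding.inl z (padZero ψ) = ket (zeros A) (z ∘ Sum.inr) • ψ := by
  have hext (y : Q → Bool) : extend (Embedding.inl (β := A)) y z = Sum.elim y (z ∘ Sum.inr) :=
    extend_eq_of_comp_eq Sum.inl_injective rfl fun b hb => by
      rcases b with q | a
      · exact absurd ⟨q, rfl⟩ hb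
      · rfl
  funext y
  simp only [slice, padZero, hext, Sum.elim_comp_inl, Sum.elim_comp_inr, Pi.smul_apply,
    smul_eq_mul, mul_comm]

theorem Realizable.of_circuit (C : Circuit Q) :
    Realizable (Circuit.apply C) (Circuit.depth C) (Circuit.size C) := by
  refine ⟨Empty, inferInstance, inferInstance, Circuit.map Embedding.inl C, fun ψ => ?_, ?_, ?_⟩
  · refine eq_of_slice_eq Embedding.inl fun z => ?_
    rw [Circuit.slice_apply_map, slice_inl_padZero, slice_inl_padZero, Circuit.apply_smul]
  · rw [Circuit.depth_map]
  · rw [Circuit.size_map]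

theorem Realizable.of_layer [Fintype Q] (L : Layer Q) :
    Realizable L.apply 1 (Fintype.card Q) :=
  (Realizable.of_circuit [L]).mono le_rfl <| by
    simpa [Circuit.size] using L.size_le_card

theorem Gate.apply_oneQubit [Fintype Q] (q : Q) (U : Matrix.unitaryGroup Bool ℂ) (ψ : State Q) :
    (Gate.oneQubit q U).apply ψ = tensorMatrix (update 1 q (U : Matrix Bool Bool ℂ)) *ᵥ ψ := by
  funext z
  refine Fintype.sum_of_injective (update z q) (update_injective z q) _ _ (fun w hw => ?_)
    fun b => ?_
  · obtain ⟨r, hrq, hr⟩ : ∃ r, r ≠ q ∧ z r ≠ w r := by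
      by_contra! h
      exact hw ⟨w q, funext fun r => by by_cases hr : r = q <;> simp_all⟩
    refine mul_eq_zero_of_left (Finset.prod_eq_zero (Finset.mem_univ r) ?_) _
    rw [update_of_ne hrq, Pi.one_apply, one_apply_ne hr]
  · refine congrArg (· * ψ (update z q b)) ((Finset.prod_eq_single q ?_ ?_).trans ?_).symm <;>
      simp +contextual [update_of_ne]

theorem realizable_tensorMatrix [Fintype Q] (U : Q → Matrix.unitaryGroup Bool ℂ) :
    Realizable (tensorMatrix (fun q => (U q : Matrix Bool Bool ℂ)) *ᵥ ·) 1 (Fintype.card Q) := by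
  have hfold (l : List Q) (hl : l.Nodup) (ψ : State Q) :
      (l.map fun q => Gate.oneQubit q (U q)).foldl (fun φ g => g.apply φ) ψ =
        tensorMatrix (fun q => if q ∈ l then (U q : Matrix Bool Bool ℂ) else 1) *ᵥ ψ := by
    induction l generalizing ψ with
    | nil => simp [tensorMatrix_one]
    | cons q l ih =>
      rw [List.nodup_cons] at hl
      rw [List.map_cons, List.foldl_cons, ih hl.2, Gate.apply_oneQubit, mulVec_mulVec,
        tensorMatrix_mul]
      congr 2
      funext r
      by_cases hr : r = q
      · subst hr; simp [hl.1]
      · simp [hr]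
  let L : Layer Q := ⟨Finset.univ.toList.map fun q => Gate.oneQubit q (U q),
    List.pairwise_map.2 <| (Finset.nodup_toList _).imp fun h => Finset.disjoint_singleton.2 h⟩
  have hL : L.apply = (tensorMatrix (fun q => (U q : Matrix Bool Bool ℂ)) *ᵥ ·) := by
    funext ψ
    simpa [L, Layer.apply] using hfold _ (Finset.nodup_toList Finset.univ) ψ
  exact hL ▸ Realizable.of_layer L

theorem realizable_oracle_comp [Fintype C] [Fintype T] (p : T → C) :
    Realizable (oracle fun x : C → Bool => x ∘ p) 1 (Fintype.card C + Fintype.card T) := by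
  let g (c : C) : Gate (C ⊕ T) :=
    .fanOut (Sum.inl c) ((Finset.univ.filter (p · = c)).map Embedding.inr) (by simp)
  have hfold (l : List C) (hl : l.Nodup) (ψ : State (C ⊕ T)) (z : C ⊕ T → Bool) :
      (l.map g).foldl (fun φ g => g.apply φ) ψ z =
        ψ (Sum.elim (z ∘ Sum.inl) fun t =>
          if p t ∈ l then z (Sum.inr t) + z (Sum.inl (p t)) else z (Sum.inr t)) := by
    induction l generalizing ψ with
    | nil => simp [← Function.comp_def]
    | cons c l ih =>
      rw [List.nodup_cons] at hl
      rw [List.map_cons, List.foldl_cons, ih hl.2, Gate.apply]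
      refine congrArg ψ (funext fun q => ?_)
      rcases q with c' | t
      · simp [fanOutBits]
      · by_cases ht : p t = c
        · simp [fanOutBits, ht, hl.1, Bool.add_eq_xor]
        · simp [fanOutBits, ht]
  have hdisjoint {c c' : C} (h : c ≠ c') : Disjoint (g c).qubits (g c').qubits := by
    simp only [g, Gate.qubits, Finset.disjoint_left, Finset.mem_insert, Finset.mem_map,
      Finset.mem_filter, Finset.mem_univ, true_and, Embedding.inr_apply]
    rintro q (rfl | ⟨t, rfl, rfl⟩) <;> simp [h]
  let L : Layer (C ⊕ T) := ⟨Finset.univ.toList.map g,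
    List.pairwise_map.2 <| (Finset.nodup_toList _).imp hdisjoint⟩
  have hL : L.apply = oracle fun x : C → Bool => x ∘ p := by
    funext ψ z
    rw [Layer.apply, hfold _ (Finset.nodup_toList _)]
    simp only [Finset.mem_toList, Finset.mem_univ, if_true]
    rfl
  rw [← hL]
  exact (Realizable.of_layer L).mono le_rfl (by simp)

omit [DecidableEq T] in
theorem xorInto_comp_dotProduct [Fintype C] [Fintype T] (p : T → C) (z w : C ⊕ T → Bool) :
    xorInto (fun x : C → Bool => x ∘ p) z ⬝ᵥ w =
      z ⬝ᵥ Sum.elim (w ∘ Sum.inl + fun c => ∑ t with p t = c, w (Sum.inr t)) (w ∘ Sum.inr) := by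
  have hfiber : ∑ c, z (Sum.inl c) * ∑ t with p t = c, w (Sum.inr t) =
      ∑ t, z (Sum.inl (p t)) * w (Sum.inr t) := by
    simp only [Finset.mul_sum, Finset.sum_filter]
    rw [Finset.sum_comm]
    simp
  simp only [dotProduct, Fintype.sum_sum_type, xorInto, Sum.elim_inl, Sum.elim_inr,
    Function.comp_apply, Pi.add_apply, add_mul, mul_add, Finset.sum_add_distrib, hfiber]
  abel

/-- A fan-out conjugated by Hadamard gates adds parities of its targets into its controls. -/
theorem realizable_oracle_sum [Fintype C] [Fintype T] (p : T → C) :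
    Realizable (oracle fun (x : T → Bool) c => ∑ t with p t = c, x t) 3
      (3 * (Fintype.card T + Fintype.card C)) := by
  let H (ψ : State (C ⊕ T)) : State (C ⊕ T) := tensorMatrix (fun _ => hadamardGate) *ᵥ ψ
  have hH : Realizable H 1 (Fintype.card (C ⊕ T)) :=
    realizable_tensorMatrix fun _ => ⟨hadamardGate, hadamardGate_mem_unitaryGroup⟩
  have hH_self (ψ : State (C ⊕ T)) : H (H ψ) = ψ := by
    simp only [H, mulVec_mulVec, tensorMatrix_mul, hadamardGate_mul_self, tensorMatrix_one,
      one_mulVec]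
  have hconj (ψ : State (C ⊕ T)) : H (oracle (fun x => x ∘ p) (H ψ)) = ψ ∘ fun w =>
      Sum.elim (w ∘ Sum.inl + fun c => ∑ t with p t = c, w (Sum.inr t)) (w ∘ Sum.inr) := by
    conv_rhs => rw [← hH_self ψ]
    exact tensorMatrix_hadamardGate_mulVec_comp (xorInto_involutive _)
      (xorInto_comp_dotProduct p) _
  have hlift : lift (Equiv.sumComm C T).toEmbedding (H ∘ oracle (fun x => x ∘ p) ∘ H) =
      oracle fun x c => ∑ t with p t = c, x t := by
    funext ψ z
    rw [lift_equiv, Function.comp_apply, Function.comp_apply, hconj]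
    refine congrArg ψ (funext ?_)
    rintro (t | c) <;> rfl
  rw [← hlift]
  refine (((hH.comp (realizable_oracle_comp p)).comp hH).lift _).mono le_rfl ?_
  rw [Fintype.card_sum]
  push_cast
  linarith

end Layers

/-! ## Computing and uncomputing -/

section Uncompute

variable {X Y A R : Type*} {D D' D₂ : ℕ} {S S' S₂ : ℝ}

theorem lift_rotation_padZero [Fintype A] [DecidableEq A] (e : (X → Bool) → (A → ℂ))
    (φ : State (X ⊕ Y)) (z : (X ⊕ Y) ⊕ A → Bool) :
    lift (Embedding.inl.sumMap (Embedding.refl A)) (rotation e) (padZero φ) z =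
      (∏ a, rot (e (z ∘ Sum.inl ∘ Sum.inl) a) (z (Sum.inr a)) false) * φ (z ∘ Sum.inl) := by
  have hext (w : A → Bool) :
      extend (Embedding.inl.sumMap (Embedding.refl A)) (Sum.elim (z ∘ Sum.inl ∘ Sum.inl) w) z =
        Sum.elim (z ∘ Sum.inl) w := by
    refine extend_eq_of_comp_eq (Embedding.injective _) (funext ?_) ?_
    · rintro (x | a) <;> rfl
    · rintro (q | a) hb
      · rfl
      · exact absurd ⟨Sum.inr a, rfl⟩ hb
  have hslice (w : A → Bool) :
      slice (Embedding.inl.sumMap (Embedding.refl A)) z (padZero φ)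
        (Sum.elim (z ∘ Sum.inl ∘ Sum.inl) w) = φ (z ∘ Sum.inl) * ket (zeros A) w := by
    rw [slice, hext]; rfl
  refine (congrArg (fun v => (tensorMatrix (fun a => rot (e (z ∘ Sum.inl ∘ Sum.inl) a)) *ᵥ v)
    (z ∘ Sum.inr)) (funext hslice)).trans ?_
  refine (Fintype.sum_eq_single (zeros A) fun w hw => ?_).trans ?_
  · exact mul_eq_zero_of_right _ (by simp only [ket_of_ne hw, mul_zero])
  · simp only [ket_self, mul_one]; rfl

/-- Compute `A` from `X`, use it as the input of `g`, and uncompute it: every outcome of the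
rotations with nonzero amplitude yields the same value of `g`, so the result is not entangled with
`A`. -/
theorem Realizable.oracle_of_rotation {A : Type} [Fintype A] [DecidableEq A] [DecidableEq X]
    [DecidableEq Y] {e : (X → Bool) → (A → ℂ)} {f : (X → Bool) → (Y → Bool)}
    {g : (A → Bool) → (Y → Bool)} (he : ∀ x a, e x a ≠ 0)
    (hgf : ∀ x w, (∀ a, rot (e x a) (w a) false ≠ 0) → g w = f x)
    (hrot : Realizable (rotation e) D S) (hg : Realizable (oracle g) D₂ S₂)
    (hinv : Realizable (rotation e⁻¹) D' S') :
    Realizable (oracle f) (D + D₂ + D') (S + S₂ + S') := by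
  let e₁ : X ⊕ A ↪ (X ⊕ Y) ⊕ A := Embedding.inl.sumMap (Embedding.refl A)
  let e₂ : A ⊕ Y ↪ (X ⊕ Y) ⊕ A := ⟨Sum.elim Sum.inr (Sum.inl ∘ Sum.inr), by
    rintro (a | y) (a' | y') <;> simp⟩
  have hg_apply (ψ : State ((X ⊕ Y) ⊕ A)) (z : (X ⊕ Y) ⊕ A → Bool) :
      FanOutCircuit.lift e₂ (oracle g) ψ z =
        ψ (Sum.elim (xorInto (fun _ => g (z ∘ Sum.inr)) (z ∘ Sum.inl)) (z ∘ Sum.inr)) := by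
    refine congrArg ψ (extend_eq_of_comp_eq e₂.injective (funext ?_) ?_)
    · rintro (a | y) <;> rfl
    · rintro ((x | y) | a) hb
      · rfl
      · exact absurd ⟨Sum.inr y, rfl⟩ hb
      · rfl
  have hg_lift (φ : State (X ⊕ Y)) :
      FanOutCircuit.lift e₂ (oracle g) (FanOutCircuit.lift e₁ (rotation e) (padZero φ)) =
        FanOutCircuit.lift e₁ (rotation e) (padZero (oracle f φ)) := by
    funext z
    rw [hg_apply, lift_rotation_padZero, lift_rotation_padZero]
    by_cases hz : ∀ a, rot (e (z ∘ Sum.inl ∘ Sum.inl) a) (z (Sum.inr a)) false ≠ 0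
    · have hval := hgf (z ∘ Sum.inl ∘ Sum.inl) (z ∘ Sum.inr) hz
      have hxor : xorInto (fun _ => g (z ∘ Sum.inr)) (z ∘ Sum.inl) = xorInto f (z ∘ Sum.inl) := by
        simp only [xorInto, hval, Function.comp_assoc]
      exact congrArg (_ * φ ·) hxor
    · push Not at hz
      obtain ⟨a, ha⟩ := hz
      rw [Finset.prod_eq_zero (Finset.mem_univ a) ha,
        Finset.prod_eq_zero (Finset.mem_univ a) (by exact ha), zero_mul, zero_mul]
  have hcancel : e⁻¹ * e = 1 := by
    ext x a
    exact inv_mul_cancel₀ (he x a)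
  refine (((hrot.lift e₁).comp (hg.lift e₂)).comp (hinv.lift e₁)).of_padZero fun φ => ?_
  rw [Function.comp_apply, Function.comp_apply, hg_lift, lift_lift, rotation_comp_rotation,
    hcancel, rotation_one, lift_id, id]

theorem Realizable.oracle_comp {A : Type} [Finite A] [DecidableEq A] [DecidableEq X]
    [DecidableEq Y] {f : (X → Bool) → (A → Bool)} {g : (A → Bool) → (Y → Bool)}
    (hf : Realizable (oracle f) D S) (hg : Realizable (oracle g) D₂ S₂) :
    Realizable (oracle (g ∘ f)) (D + D₂ + D) (S + S₂ + S) := by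
  cases nonempty_fintype A
  rw [← rotation_sign] at hf
  refine oracle_of_rotation (fun x a => ?_)
    (fun x w hw => congrArg g (funext fun a => rot_sign_ne_zero_iff.1 (hw a))) hf hg ?_
  · exact left_ne_zero_of_mul_eq_one (sign_mul_self (f x a))
  · convert hf using 2
    funext x a
    exact inv_eq_of_mul_eq_one_right (sign_mul_self (f x a))

theorem Realizable.phaseOp_of_oracle {K : Type} [Fintype K] [DecidableEq K] [DecidableEq R]
    {f : (R → Bool) → (K → Bool)} (hf : Realizable (oracle f) D S) {u : K → ℂ}
    (hu : ∀ k, ‖u k‖ = 1) :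
    Realizable (phaseOp fun x => ∏ k, phase (u k) (f x k)) (D + 1 + D)
      (S + Fintype.card K + S) := by
  have hphase := (realizable_tensorMatrix fun k =>
    ⟨diagonal (phase (u k)), diagonal_phase_mem_unitaryGroup (hu k)⟩).lift (Embedding.inr (α := R))
  have hlift (ψ : State (R ⊕ K)) (z : R ⊕ K → Bool) :
      FanOutCircuit.lift Embedding.inr
        (tensorMatrix (fun k => diagonal (phase (u k))) *ᵥ ·) ψ z =
          (∏ k, phase (u k) (z (Sum.inr k))) * ψ z := by
    simp only [tensorMatrix_diagonal, lift_inr, mulVec_diagonal, Function.comp_apply,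
      Sum.elim_comp_inl_inr]
  refine ((hf.comp hphase).comp hf).of_padZero fun φ => funext fun z => ?_
  rw [Function.comp_apply, Function.comp_apply, oracle, Function.comp_apply, hlift, oracle,
    Function.comp_apply, xorInto_involutive]
  by_cases hz : z ∘ Sum.inr = zeros K
  · simp only [padZero, hz, ket_self, mul_one, phaseOp, xorInto, Sum.elim_inr, Pi.add_apply]
    simp only [zeros, ← Bool.zero_eq_false, zero_add]
  · simp only [padZero, ket_of_ne hz, mul_zero]

end Uncompute

/-! ## Phases and rotations by functions of parities -/

section Parities

variable {R T K : Type} [Fintype R] [DecidableEq R] [Fintype T] [DecidableEq T] [Fintype K]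

theorem realizable_oracle_parity [DecidableEq K] (s : K → Finset R) :
    Realizable (oracle fun (x : R → Bool) k => ∑ q ∈ s k, x q) 5
      (5 * (Fintype.card R + ∑ k, ((s k).card + 1))) := by
  have hsum (x : R → Bool) (k : K) :
      ∑ t : (Σ k, s k) with t.1 = k, x t.2 = ∑ q ∈ s k, x q := by
    rw [Finset.sum_filter, Fintype.sum_sigma, Fintype.sum_eq_single k]
    · simp only [if_true, Finset.sum_coe_sort (s k) x]
    · intro k' hk'
      simp only [hk', if_false, Finset.sum_const_zero]
  have hcomp := (realizable_oracle_comp fun t : Σ k, s k => (t.2 : R)).oracle_comp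
    (realizable_oracle_sum Sigma.fst)
  have hfun : (fun x k => ∑ t : (Σ k, s k) with t.1 = k, x t) ∘
      (fun x : R → Bool => x ∘ fun t : Σ k, s k => (t.2 : R)) =
        fun x k => ∑ q ∈ s k, x q := funext fun x => funext (hsum x)
  rw [hfun] at hcomp
  refine hcomp.mono le_rfl ?_
  simp only [Fintype.card_sigma, Fintype.card_coe, Finset.sum_add_distrib, Finset.sum_const,
    Finset.card_univ, smul_eq_mul, mul_one]
  push_cast
  linarith [Nat.cast_nonneg (α := ℝ) (Fintype.card R), Nat.cast_nonneg (α := ℝ) (Fintype.card K)]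

theorem realizable_phaseOp_parity {u : K → ℂ} (hu : ∀ k, ‖u k‖ = 1) (s : K → Finset R) :
    Realizable (phaseOp fun x => ∏ k, phase (u k) (∑ q ∈ s k, x q)) 11
      (11 * (Fintype.card R + ∑ k, ((s k).card + 1))) := by
  classical
  refine ((realizable_oracle_parity s).phaseOp_of_oracle hu).mono le_rfl ?_
  have hcard : Fintype.card K ≤ ∑ k, ((s k).card + 1) := by
    rw [Finset.sum_add_distrib, ← Finset.card_eq_sum_ones, Finset.card_univ]
    exact Nat.le_add_left _ _
  exact_mod_cast (by omega)

/-- By `phase_sq_mul` with `u ^ 2 = v`, a phase by a product is a product of phases by parities. -/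
theorem realizable_phaseOp_parity_mul {v : K → ℂ} (hv : ∀ k, ‖v k‖ = 1) (s : K → Finset R)
    (τ : K → T) :
    Realizable
      (phaseOp fun z => ∏ k, phase (v k) ((∑ q ∈ s k, z (Sum.inl q)) * z (Sum.inr (τ k)))) 11
      (11 * (Fintype.card R + Fintype.card T + 5 * ∑ k, ((s k).card + 1))) := by
  choose u hu using fun k => IsSquare.exists_sq (v k) (IsAlgClosed.exists_eq_mul_self (v k))
  have hnorm (k : K) : ‖u k‖ = 1 :=
    (pow_eq_one_iff_of_nonneg (norm_nonneg _) two_ne_zero).1 <| by rw [← norm_pow, ← hu, hv]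
  have hne (k : K) : u k ≠ 0 := norm_ne_zero_iff.1 (by rw [hnorm]; exact one_ne_zero)
  have hparity := realizable_phaseOp_parity (R := R ⊕ T)
    (u := Sum.elim u (Sum.elim u u⁻¹))
    (by rintro (k | k | k) <;> simp [hnorm])
    (Sum.elim (fun k => (s k).disjSum ∅)
      (Sum.elim (fun k => (∅ : Finset R).disjSum {τ k}) fun k => (s k).disjSum {τ k}))
  simp only [Fintype.prod_sum_type, Fintype.sum_sum_type, Sum.elim_inl, Sum.elim_inr,
    Finset.sum_disjSum, Finset.sum_empty, Finset.sum_singleton, Finset.card_disjSum,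
    Finset.card_empty, Finset.card_singleton, add_zero, zero_add, ← Finset.prod_mul_distrib,
    ← mul_assoc, Pi.inv_apply, ← phase_sq_mul (hne _), ← hu, Fintype.card_sum] at hparity
  refine hparity.mono le_rfl ?_
  simp only [Finset.sum_add_distrib, Finset.sum_const, Finset.card_univ, nsmul_eq_mul]
  push_cast
  linarith [Finset.sum_nonneg fun k (_ : k ∈ Finset.univ) => Nat.cast_nonneg (α := ℝ) (s k).card]

theorem phase_phase (v : ℂ) (b c : Bool) : phase (phase v b) c = phase v (b * c) := by
  cases b <;> cases c <;> simp [phase, Bool.mul_eq_and]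

omit [Fintype K] in
theorem phase_prod (s : Finset K) (u : K → ℂ) (b : Bool) :
    phase (∏ k ∈ s, u k) b = ∏ k ∈ s, phase (u k) b := by
  cases b <;> simp [phase]

theorem realizable_rotation_parity {v : K → ℂ} (hv : ∀ k, ‖v k‖ = 1) (s : K → Finset R)
    (τ : K → T) :
    Realizable
      (rotation fun (x : R → Bool) t => ∏ k with τ k = t, phase (v k) (∑ q ∈ s k, x q)) 13
      (13 * (Fintype.card R + Fintype.card T) + 55 * ∑ k, ((s k).card + 1)) := by
  have hphase (z : R ⊕ T → Bool) :
      ∏ t, phase (∏ k with τ k = t, phase (v k) (∑ q ∈ s k, (z ∘ Sum.inl) q)) (z (Sum.inr t)) =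
        ∏ k, phase (v k) ((∑ q ∈ s k, z (Sum.inl q)) * z (Sum.inr (τ k))) := by
    simp only [phase_prod, phase_phase, Function.comp_apply]
    rw [← Finset.prod_fiberwise Finset.univ τ]
    refine Finset.prod_congr rfl fun t _ => Finset.prod_congr rfl fun k hk => ?_
    rw [(Finset.mem_filter.1 hk).2]
  have hH := (realizable_tensorMatrix fun _ : T =>
    ⟨hadamardGate, hadamardGate_mem_unitaryGroup⟩).lift (Embedding.inr (α := R))
  rw [rotation_eq_hadamardGate_comp]
  simp only [hphase]
  refine ((hH.comp (realizable_phaseOp_parity_mul hv s τ)).comp hH).mono le_rfl ?_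
  linarith [Nat.cast_nonneg (α := ℝ) (Fintype.card R)]

end Parities

/-! ## Disjunctions over blocks -/

section Blocks

/-- The primitive `2 ^ m`-th root of unity `exp (2πi / 2 ^ m)`. -/
noncomputable def dyadicRoot (m : ℕ) : ℂ :=
  Complex.exp (2 * Real.pi * Complex.I / 2 ^ m)

theorem norm_dyadicRoot (m : ℕ) : ‖dyadicRoot m‖ = 1 := by
  convert Complex.norm_exp_ofReal_mul_I (2 * Real.pi / 2 ^ m) using 2
  rw [dyadicRoot]
  push_cast
  ring_nf

theorem dyadicRoot_succ_pow (i : ℕ) (k : ℕ) : dyadicRoot (i + 1) ^ (2 ^ i * k) = (-1) ^ k := by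
  rw [pow_mul, dyadicRoot, ← Complex.exp_nat_mul, ← Complex.exp_pi_mul_I]
  congr 2
  field_simp
  push_cast
  ring

theorem exists_dyadicRoot_pow_eq_neg_one {m w : ℕ} (hw : w ≠ 0) (hwm : w < 2 ^ m) :
    ∃ i : Fin m, dyadicRoot (i + 1) ^ w = -1 := by
  obtain ⟨i, k, hk, rfl⟩ := Nat.exists_eq_two_pow_mul_odd hw
  have him : i < m := (Nat.pow_lt_pow_iff_right one_lt_two).1 <|
    (Nat.le_mul_of_pos_right _ hk.pos).trans_lt hwm
  exact ⟨⟨i, him⟩, by rw [dyadicRoot_succ_pow, hk.neg_one_pow]⟩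

/-- The disjunction of the bits in each fiber of `β`. -/
noncomputable def blockOr {X Y : Type*} (β : X → Y) (x : X → Bool) (j : Y) : Bool :=
  open Classical in decide (∃ q, β q = j ∧ x q = true)

theorem blockOr_eq_true_iff {X Y : Type*} {β : X → Y} {x : X → Bool} {j : Y} :
    blockOr β x j = true ↔ ∃ q, β q = j ∧ x q = true := by
  simp only [blockOr, decide_eq_true_eq]

theorem blockOr_comp_blockOr {X Y Z : Type*} (γ : Y → Z) (β : X → Y) :
    blockOr γ ∘ blockOr β = blockOr (γ ∘ β) := by
  funext x j
  rw [Bool.eq_iff_iff]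
  simp only [Function.comp_apply, blockOr_eq_true_iff]
  constructor
  · rintro ⟨_, rfl, q, rfl, hq⟩
    exact ⟨q, rfl, hq⟩
  · rintro ⟨q, rfl, hq⟩
    exact ⟨β q, rfl, q, rfl, hq⟩

theorem sum_powerset_sign_sum {X : Type*} (s : Finset X) (x : X → Bool) :
    ∑ t ∈ s.powerset, sign (∑ q ∈ t, x q) = if ∃ q ∈ s, x q = true then 0 else 2 ^ s.card := by
  simp only [sign_sum, ← Finset.prod_one_add]
  split_ifs with h
  · obtain ⟨q, hq, hx⟩ := h
    exact Finset.prod_eq_zero hq (by rw [hx, sign_true, add_neg_cancel])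
  · push Not at h
    rw [← Finset.prod_const]
    refine Finset.prod_congr rfl fun q hq => ?_
    rw [Bool.eq_false_iff.2 (h q hq), sign_false, one_add_one_eq_two]

/-- If some bit of `s` is set then exactly half of the subsets of `s` have odd parity. -/
theorem prod_powerset_phase_sum {X : Type*} (s : Finset X) (x : X → Bool) :
    ∏ t ∈ s.powerset, phase (dyadicRoot s.card) (∑ q ∈ t, x q) =
      if ∃ q ∈ s, x q = true then -1 else 1 := by
  set N := (s.powerset.filter fun t => ∑ q ∈ t, x q = true).card with hN
  have hprod : ∏ t ∈ s.powerset, phase (dyadicRoot s.card) (∑ q ∈ t, x q) =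
      dyadicRoot s.card ^ N := by
    simp only [phase, Finset.prod_ite, Finset.prod_const, one_pow, mul_one, hN]
  have hsign (b : Bool) : sign b = 1 - 2 * if b = true then 1 else 0 := by
    cases b <;> norm_num [sign_true, sign_false]
  have hsum := sum_powerset_sign_sum s x
  simp only [hsign, Finset.sum_sub_distrib, ← Finset.mul_sum, Finset.sum_boole, Finset.sum_const,
    Finset.card_powerset, nsmul_eq_mul, mul_one, ← hN, Nat.cast_pow, Nat.cast_ofNat] at hsum
  rw [hprod]
  split_ifs at hsum ⊢ with h
  · have hhalf : 2 ^ s.card = 2 * N := by exact_mod_cast sub_eq_zero.1 hsum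
    obtain ⟨q, hq, -⟩ := h
    obtain ⟨i, hi⟩ := Nat.exists_eq_succ_of_ne_zero (Finset.card_ne_zero_of_mem hq)
    have hNi : N = 2 ^ i * 1 := by rw [hi, pow_succ] at hhalf; omega
    rw [hNi, hi, dyadicRoot_succ_pow, pow_one]
  · have hzero : N = 0 := by simpa using hsum
    rw [hzero, pow_zero]

variable {X Y : Type} [Fintype X] [DecidableEq X] [Fintype Y] [DecidableEq Y]

theorem realizable_oracle_blockOr (β : X → Y) {m : ℕ}
    (hβ : ∀ j, (Finset.univ.filter (β · = j)).card ≤ m) :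
    Realizable (oracle (blockOr β)) 13
      (13 * (Fintype.card X + Fintype.card Y) + 55 * (Fintype.card Y * 2 ^ m * (m + 1))) := by
  let block (j : Y) : Finset X := Finset.univ.filter (β · = j)
  have hrot := realizable_rotation_parity
    (K := Σ j, (block j).powerset) (v := fun k => dyadicRoot (block k.1).card)
    (fun _ => norm_dyadicRoot _) (fun k => (k.2 : Finset X)) Sigma.fst
  have hsign (x : X → Bool) (j : Y) :
      ∏ k : (Σ j, (block j).powerset) with k.1 = j,
        phase (dyadicRoot (block k.1).card) (∑ q ∈ (k.2 : Finset X), x q) =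
          sign (blockOr β x j) := by
    rw [Finset.prod_filter, Fintype.prod_sigma, Fintype.prod_eq_single j]
    · simp only [if_true]
      rw [Finset.prod_coe_sort (block j).powerset
        fun t => phase (dyadicRoot (block j).card) (∑ q ∈ t, x q), prod_powerset_phase_sum]
      simp [sign, blockOr, block]
    · intro j' hj'
      simp only [hj', if_false, Finset.prod_const_one]
  simp only [hsign, rotation_sign] at hrot
  refine hrot.mono le_rfl ?_
  have hcard : ∑ k : (Σ j, (block j).powerset), ((k.2 : Finset X).card + 1) ≤
      Fintype.card Y * 2 ^ m * (m + 1) := by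
    refine (Finset.sum_le_card_nsmul _ _ (m + 1) fun k _ => ?_).trans ?_
    · exact Nat.succ_le_succ ((Finset.card_le_card (Finset.mem_powerset.1 k.2.2)).trans (hβ k.1))
    · rw [Finset.card_univ, Fintype.card_sigma, smul_eq_mul]
      refine Nat.mul_le_mul_right _ (Finset.sum_le_card_nsmul _ _ _ fun j _ => ?_)
      rw [Fintype.card_coe, Finset.card_powerset]
      exact Nat.pow_le_pow_right two_pos (hβ j)
  gcongr
  exact_mod_cast hcard

/-- The Hamming weight of the bits in the fiber of `β` over `j`. -/
def blockWeight (β : X → Y) (x : X → Bool) (j : Y) : ℕ :=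
  (Finset.univ.filter fun q => β q = j ∧ x q = true).card

omit [DecidableEq X] [Fintype Y] in
theorem blockWeight_ne_zero_iff {β : X → Y} {x : X → Bool} {j : Y} :
    blockWeight β x j ≠ 0 ↔ blockOr β x j = true := by
  simp [blockWeight, blockOr_eq_true_iff, Finset.filter_eq_empty_iff]

theorem realizable_rotation_blockWeight (β : X → Y) {m : ℕ} {w : Fin m → ℂ}
    (hw : ∀ i, ‖w i‖ = 1) :
    Realizable (rotation fun x (t : Y × Fin m) => w t.2 ^ blockWeight β x t.1) 13
      (13 * (Fintype.card X + Fintype.card Y * m) + 110 * (Fintype.card X * m)) := by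
  have hrot := realizable_rotation_parity (K := X × Fin m) (v := fun k => w k.2) (fun k => hw k.2)
    (fun k => {k.1}) (Prod.map β id)
  have hpow (x : X → Bool) (t : Y × Fin m) :
      ∏ k : X × Fin m with Prod.map β id k = t, phase (w k.2) (x k.1) =
        w t.2 ^ blockWeight β x t.1 := by
    obtain ⟨j, i⟩ := t
    simp only [blockWeight, ← Finset.prod_const, Finset.prod_filter, Fintype.prod_prod_type,
      Prod.map_apply, id, Prod.mk.injEq, phase]
    refine Finset.prod_congr rfl fun q _ => ?_
    rw [Fintype.prod_eq_single i fun i' hi' => if_neg fun h => hi' h.2]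
    simp only [and_true, ite_and]
  simp only [Finset.sum_singleton, hpow] at hrot
  refine hrot.mono le_rfl (le_of_eq ?_)
  simp only [Fintype.card_prod, Fintype.card_fin, Finset.card_singleton, Finset.sum_const,
    Finset.card_univ, smul_eq_mul]
  push_cast
  ring

omit [DecidableEq X] [Fintype Y] in
theorem blockOr_fst_eq_of_rot_ne_zero {β : X → Y} {m : ℕ}
    (hβ : ∀ j, (Finset.univ.filter (β · = j)).card < 2 ^ m) {x : X → Bool}
    {b : Y × Fin m → Bool}
    (hb : ∀ t, rot (dyadicRoot (t.2 + 1) ^ blockWeight β x t.1) (b t) false ≠ 0) :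
    blockOr Prod.fst b = blockOr β x := by
  funext j
  by_cases hw : blockWeight β x j = 0
  · have hbj (i : Fin m) : b (j, i) = false := rot_sign_ne_zero_iff.1 <| by
      simpa only [hw, pow_zero, sign_false] using hb (j, i)
    have hx : ¬blockOr β x j = true := fun h => blockWeight_ne_zero_iff.2 h hw
    rw [Bool.eq_iff_iff, iff_false_right hx, blockOr_eq_true_iff]
    rintro ⟨⟨_, i⟩, rfl, hi⟩
    exact Bool.false_ne_true ((hbj i).symm.trans hi)
  · have hlt : blockWeight β x j < 2 ^ m :=
      (Finset.card_le_card <| Finset.monotone_filter_right _ fun _ _ h => h.1).trans_lt (hβ j)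
    obtain ⟨i, hi⟩ := exists_dyadicRoot_pow_eq_neg_one hw hlt
    have hbj : b (j, i) = true := rot_sign_ne_zero_iff.1 <| by
      simpa only [hi, sign_true] using hb (j, i)
    rw [blockWeight_ne_zero_iff.1 hw, blockOr_eq_true_iff]
    exact ⟨(j, i), rfl, hbj⟩

theorem realizable_oracle_blockOr_of_card_lt (β : X → Y) {m : ℕ}
    (hβ : ∀ j, (Finset.univ.filter (β · = j)).card < 2 ^ m) :
    Realizable (oracle (blockOr β)) 39
      (2 * (13 * (Fintype.card X + Fintype.card Y * m) + 110 * (Fintype.card X * m)) +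
        (13 * (Fintype.card Y * m + Fintype.card Y) +
          55 * (Fintype.card Y * 2 ^ m * (m + 1)))) := by
  have hrot := realizable_rotation_blockWeight β fun i : Fin m => norm_dyadicRoot (i + 1)
  have hinv := realizable_rotation_blockWeight β (w := fun i : Fin m => (dyadicRoot (i + 1))⁻¹)
    fun i => by rw [norm_inv, norm_dyadicRoot, inv_one]
  have hfst (j : Y) : (Finset.univ.filter fun t : Y × Fin m => t.1 = j).card ≤ m := by
    have hprod : (Finset.univ.filter fun t : Y × Fin m => t.1 = j) = {j} ×ˢ Finset.univ := by
      ext ⟨j', i⟩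
      simp [eq_comm]
    rw [hprod, Finset.card_product, Finset.card_singleton, one_mul, Finset.card_fin]
  have hne (x : X → Bool) (t : Y × Fin m) : dyadicRoot (t.2 + 1) ^ blockWeight β x t.1 ≠ 0 :=
    pow_ne_zero _ (norm_ne_zero_iff.1 (by rw [norm_dyadicRoot]; exact one_ne_zero))
  simp only [inv_pow] at hinv
  refine (Realizable.oracle_of_rotation hne (fun _ _ => blockOr_fst_eq_of_rot_ne_zero hβ) hrot
    (realizable_oracle_blockOr _ hfst) hinv).mono le_rfl (le_of_eq ?_)
  simp only [Fintype.card_prod, Fintype.card_fin]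
  push_cast
  ring

end Blocks

/-! ## The iterated logarithm and the recursion -/

section Recursion

theorem one_le_ilog (d : ℕ) {x : ℝ} (hx : 1 ≤ x) : 1 ≤ ilog d x := by
  cases d with
  | zero => exact hx
  | succ d => exact le_max_left _ _

theorem ilog_le_ilog (d : ℕ) {x y : ℝ} (hx : 1 ≤ x) (hxy : x ≤ y) : ilog d x ≤ ilog d y := by
  induction d with
  | zero => exact hxy
  | succ d ih =>
    exact max_le_max_left _ <| Real.logb_le_logb_of_le one_lt_two
      (zero_lt_one.trans_le (one_le_ilog d hx)) ih

theorem ilog_le_self (d : ℕ) {x : ℝ} (hx : 1 ≤ x) : ilog d x ≤ x := by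
  induction d with
  | zero => exact le_rfl
  | succ d ih =>
    have hpos : 1 ≤ ilog d x := one_le_ilog d hx
    have hbernoulli := one_add_mul_self_le_rpow_one_add (s := 1) (by norm_num) hpos
    refine max_le hx (le_trans ?_ ih)
    rw [Real.logb_le_iff_le_rpow one_lt_two (by linarith)]
    norm_num at hbernoulli
    linarith

theorem natLog_ceil_add_one_le {x : ℝ} (hx : 1 ≤ x) :
    (Nat.log 2 ⌈x⌉₊ + 1 : ℝ) ≤ 3 * max 1 (Real.logb 2 x) := by
  have hceil_pos : 0 < (⌈x⌉₊ : ℝ) := zero_lt_one.trans_le (hx.trans (Nat.le_ceil x))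
  have hceil : (⌈x⌉₊ : ℝ) ≤ 2 * x := by linarith [Nat.ceil_lt_add_one (zero_le_one.trans hx)]
  have hlog : (Nat.log 2 ⌈x⌉₊ : ℝ) ≤ 1 + Real.logb 2 x :=
    calc (Nat.log 2 ⌈x⌉₊ : ℝ) ≤ Real.logb 2 ⌈x⌉₊ := by exact_mod_cast Real.natLog_le_logb ⌈x⌉₊ 2
      _ ≤ Real.logb 2 (2 * x) := Real.logb_le_logb_of_le one_lt_two hceil_pos hceil
      _ = 1 + Real.logb 2 x := by
        rw [Real.logb_mul two_ne_zero (by linarith), Real.logb_self_eq_one one_lt_two]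
  linarith [le_max_left 1 (Real.logb 2 x), le_max_right 1 (Real.logb 2 x)]

theorem exists_blocks {n B : ℕ} (hB : 1 ≤ B) (hBn : B ≤ n) :
    ∃ N, 1 ≤ N ∧ N ≤ n ∧ N * B ≤ 2 * n ∧
      ∃ β : Fin n → Fin N, ∀ j, (Finset.univ.filter (β · = j)).card ≤ B := by
  have hdiv := Nat.div_mul_le_self (n - 1) B
  have hdiv' := Nat.div_le_self (n - 1) B
  refine ⟨(n - 1) / B + 1, Nat.le_add_left _ _, by omega, by rw [add_mul]; omega,
    fun q => ⟨q / B, Nat.lt_succ_of_le (Nat.div_le_div_right (Nat.le_sub_one_of_lt q.2))⟩,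
    fun j => ?_⟩
  calc _ ≤ (Finset.Ico (j * B) (j * B + B)).card := by
        refine Finset.card_le_card_of_injOn Fin.val (fun q hq => ?_) Fin.val_injective.injOn
        have hqj : q / B = (j : ℕ) := congrArg Fin.val (Finset.mem_filter.1 hq).2
        rw [Finset.mem_coe, Finset.mem_Ico, ← hqj]
        exact ⟨Nat.div_mul_le_self _ _, Nat.lt_div_mul_add hB⟩
    _ = B := by rw [Nat.card_Ico, Nat.add_sub_cancel_left]

theorem realizable_oracle_blockOr_log {X Y : Type} [Fintype X] [DecidableEq X] [Fintype Y]
    [DecidableEq Y] {B : ℕ} (hB : 1 ≤ B) (hYX : Fintype.card Y ≤ Fintype.card X)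
    (hYB : Fintype.card Y * B ≤ 2 * Fintype.card X) (β : X → Y)
    (hβ : ∀ j, (Finset.univ.filter (β · = j)).card ≤ B) :
    Realizable (oracle (blockOr β)) 39 (738 * (Fintype.card X * (Nat.log 2 B + 1))) := by
  have hlt : B < 2 ^ (Nat.log 2 B + 1) := Nat.lt_pow_succ_log_self one_lt_two B
  have hle : 2 ^ (Nat.log 2 B + 1) ≤ 2 * B := by
    rw [pow_succ']
    exact Nat.mul_le_mul_left 2 (Nat.pow_log_le_self 2 (Nat.one_le_iff_ne_zero.1 hB))
  refine (realizable_oracle_blockOr_of_card_lt β fun j => (hβ j).trans_lt hlt).mono le_rfl ?_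
  have hpow : Fintype.card Y * 2 ^ (Nat.log 2 B + 1) ≤ 4 * Fintype.card X := by nlinarith
  generalize hm : Nat.log 2 B + 1 = m at hpow
  have h1m : 1 ≤ m := hm ▸ Nat.le_add_left _ _
  generalize Fintype.card X = x at hYX hpow
  generalize Fintype.card Y = y at hYX hpow
  have hx : x ≤ x * m := Nat.le_mul_of_pos_right x h1m
  have hy : y * m ≤ x * m := Nat.mul_le_mul_right m hYX
  have hexp : y * 2 ^ m * (m + 1) ≤ 4 * x * (2 * m) := Nat.mul_le_mul hpow (by omega)
  have hsize : 2 * (13 * (x + y * m) + 110 * (x * m)) +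
      (13 * (y * m + y) + 55 * (y * 2 ^ m * (m + 1))) ≤ 738 * (x * m) := by nlinarith
  rw [← hm] at hsize ⊢
  exact_mod_cast hsize

theorem realizable_oracle_or (d : ℕ) {n : ℕ} (hn : 1 ≤ n) :
    Realizable (oracle (blockOr fun _ : Fin n => (0 : Fin 1))) (39 * (2 * d + 1))
      (4428 * (n * ilog d n) + 8856 * (d * n)) := by
  induction d generalizing n with
  | zero =>
    refine (realizable_oracle_blockOr_log hn (by simpa using hn) (by simp; omega) _ fun j =>
      (Finset.card_le_univ _).trans_eq (Fintype.card_fin n)).mono le_rfl ?_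
    have hlog : (Nat.log 2 n + 1 : ℝ) ≤ n := by
      exact_mod_cast Nat.log_lt_self 2 (Nat.one_le_iff_ne_zero.1 hn)
    have hmul : (n * (Nat.log 2 n + 1) : ℝ) ≤ n * n := by gcongr
    rw [Fintype.card_fin, ilog]
    norm_num
    nlinarith
  | succ d ih =>
    have hn' : (1 : ℝ) ≤ n := by exact_mod_cast hn
    have hL : 1 ≤ ilog d n := one_le_ilog d hn'
    have hB : 1 ≤ ⌈ilog d n⌉₊ := Nat.one_le_ceil_iff.2 (zero_lt_one.trans_le hL)
    obtain ⟨N, hN, hNn, hNB, β, hβ⟩ := exists_blocks hB (Nat.ceil_le.2 (ilog_le_self d hn'))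
    have hblocks := realizable_oracle_blockOr_log hB (by simpa using hNn) (by simpa using hNB) β hβ
    have hcomp := hblocks.oracle_comp (ih hN)
    rw [blockOr_comp_blockOr] at hcomp
    refine hcomp.mono (by omega) ?_
    have hlog : (n * (Nat.log 2 ⌈ilog d n⌉₊ + 1) : ℝ) ≤ n * (3 * ilog (d + 1) n) := by
      gcongr
      exact natLog_ceil_add_one_le hL
    have hilog : N * ilog d N ≤ 2 * n :=
      calc N * ilog d N ≤ N * ⌈ilog d n⌉₊ := by
            gcongr
            exact (ilog_le_ilog d (by exact_mod_cast hN) (by exact_mod_cast hNn)).trans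
              (Nat.le_ceil _)
        _ ≤ 2 * n := by exact_mod_cast hNB
    have hdN : (d * N : ℝ) ≤ d * n := by gcongr
    rw [Fintype.card_fin]
    push_cast
    linarith

end Recursion

/-! ## Or-reductions -/

section OrReduction

theorem ket_comp_equiv {Q Q' : Type*} (σ : Q ≃ Q') (x : Q → Bool) (z : Q' → Bool) :
    ket x (z ∘ σ) = ket (x ∘ σ.symm) z := by
  classical exact if_congr (σ.eq_comp_symm _ _).symm rfl rfl

theorem Circuit.apply_map_ket {Q Q' : Type*} [DecidableEq Q] [DecidableEq Q'] (σ : Q ≃ Q')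
    {C : Circuit Q} {x y : Q → Bool} (h : Circuit.apply C (ket x) = ket y) :
    Circuit.apply (Circuit.map σ.toEmbedding C) (ket (x ∘ σ.symm)) = ket (y ∘ σ.symm) := by
  have hx : (fun w => ket (x ∘ σ.symm) (w ∘ σ.symm)) = ket x := funext fun w => by
    rw [ket_comp_equiv, σ.symm_symm, Function.comp_assoc, σ.symm_comp_self, Function.comp_id]
  funext z
  rw [Circuit.apply_map, lift_equiv, hx, h]
  exact ket_comp_equiv σ y z

theorem padZero_ket {Q A : Type*} (x : Q → Bool) :
    padZero (ket x) = ket (Sum.elim x (zeros A)) :=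
  funext fun _ => (ket_sumElim _ _ _).symm

theorem tensor₃_ket {A B D : Type*} (x : A → Bool) (y : B → Bool) (t : D → Bool) :
    tensor₃ (ket x) (ket y) (ket t) = ket (Sum.elim x (Sum.elim y t)) :=
  funext fun z => by rw [ket_sumElim, ket_sumElim, ← mul_assoc]; rfl

theorem oracle_ket {X Y : Type*} (f : (X → Bool) → (Y → Bool)) (z : X ⊕ Y → Bool) :
    oracle f (ket z) = ket (xorInto f z) := by
  classical exact funext fun _ => if_congr (xorInto_involutive f).eq_iff rfl rfl

theorem hammingWeight_ne_zero_iff {n : ℕ} {x : Fin n → Bool} {j : Fin 1} :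
    hammingWeight x ≠ 0 ↔ blockOr (fun _ => j) x j = true := by
  simp [hammingWeight, blockOr_eq_true_iff, Finset.filter_eq_empty_iff]

theorem Realizable.exists_isOrReduction {n D : ℕ} {S : ℝ}
    (h : Realizable (oracle (blockOr fun _ : Fin n => (0 : Fin 1))) D S) :
    ∃ (a : ℕ) (C : Circuit (Fin n ⊕ Fin 1 ⊕ Fin a)),
      IsOrReduction 0 C ∧ Circuit.depth C ≤ D ∧ (Circuit.size C : ℝ) ≤ S := by
  obtain ⟨A, _, _, C, hC, hD, hS⟩ := h
  let σ : (Fin n ⊕ Fin 1) ⊕ A ≃ Fin n ⊕ Fin 1 ⊕ Fin (Fintype.card A) :=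
    (Equiv.sumAssoc _ _ _).trans
      ((Equiv.refl _).sumCongr ((Equiv.refl _).sumCongr (Fintype.equivFin A)))
  have hσ (x : Fin n → Bool) (y : Fin 1 → Bool) :
      Sum.elim (Sum.elim x y) (zeros A) ∘ σ.symm = Sum.elim x (Sum.elim y (zeros _)) := by
    funext q
    rcases q with i | j | k <;> rfl
  refine ⟨Fintype.card A, Circuit.map σ.toEmbedding C, fun x => ?_, ?_, ?_⟩
  · let y : Fin 1 → Bool := blockOr (fun _ => 0) x
    have hket : Circuit.apply C (ket (Sum.elim (Sum.elim x (zeros _)) (zeros A))) =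
        ket (Sum.elim (Sum.elim x y) (zeros A)) := by
      have hxor : xorInto (blockOr fun _ => 0) (Sum.elim x (zeros _)) = Sum.elim x y :=
        congrArg (Sum.elim x) (zero_add y)
      rw [← padZero_ket, hC, oracle_ket, hxor, padZero_ket]
    refine ⟨ket y, ?_, fun hx => ?_, fun hx => ?_⟩
    · rw [tensor₃_ket, tensor₃_ket, ← hσ, ← hσ, Circuit.apply_map_ket σ hket]
    · refine congrArg ket (funext fun j => ?_)
      rw [Subsingleton.elim j 0]
      exact Bool.eq_false_iff.2 fun hy => hammingWeight_ne_zero_iff.2 hy hx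
    · have hy : zeros (Fin 1) ≠ y := fun hzero =>
        Bool.false_ne_true ((congrFun hzero 0).trans (hammingWeight_ne_zero_iff.1 hx))
      rw [ket_of_ne hy, norm_zero]
  · rwa [Circuit.depth_map]
  · rwa [Circuit.size_map]

theorem IsOrReduction.mono {n m a : ℕ} {ε ε' : ℝ} {C : Circuit (Fin n ⊕ Fin m ⊕ Fin a)}
    (hC : IsOrReduction ε C) (hε : ε ≤ ε') : IsOrReduction ε' C := fun x =>
  let ⟨φ, happly, hzero, hnorm⟩ := hC x
  ⟨φ, happly, hzero, fun hx => (hnorm hx).trans hε⟩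

end OrReduction

end FanOutCircuit

open FanOutCircuit in
theorem mainTheorem9_general :
    ∃ c₁ c₂ : ℝ, ∀ d : ℕ, 1 ≤ d → ∀ n : ℕ, 1 ≤ n →
      ∃ (a : ℕ) (C : Circuit (Fin n ⊕ Fin 1 ⊕ Fin a)),
        IsOrReduction 0 C ∧ (Circuit.depth C : ℝ) ≤ c₁ * d ∧
        (Circuit.size C : ℝ) ≤ c₂ * d * n * ilog d n := by
  refine ⟨117, 13284, fun d hd n hn => ?_⟩
  obtain ⟨a, C, hC, hdepth, hsize⟩ := (realizable_oracle_or d hn).exists_isOrReduction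
  refine ⟨a, C, hC, by exact_mod_cast hdepth.trans (by omega), hsize.trans ?_⟩
  have hlog : 1 ≤ ilog d n := one_le_ilog d (by exact_mod_cast hn)
  have hd' : (1 : ℝ) ≤ d := by exact_mod_cast hd
  have hd_mul : n * ilog d n ≤ d * (n * ilog d n) := le_mul_of_one_le_left (by positivity) hd'
  have hlog_mul : (d * n : ℝ) ≤ d * n * ilog d n := le_mul_of_one_le_right (by positivity) hlog
  linarith

theorem mainTheorem9 :
    ∃ c₁ c₂ : ℝ, ∀ d : ℕ, 1 ≤ d → ∀ n : ℕ, 1 ≤ n →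
      ∃ (a : ℕ) (C : FanOutCircuit.Circuit (Fin n ⊕ Fin 1 ⊕ Fin a)),
        FanOutCircuit.IsOrReduction (1 / (n : ℝ)) C ∧
        (FanOutCircuit.Circuit.depth C : ℝ) ≤ c₁ * d ∧
        (FanOutCircuit.Circuit.size C : ℝ) ≤ c₂ * d * n * FanOutCircuit.ilog d n := by
  obtain ⟨c₁, c₂, h⟩ := mainTheorem9_general
  exact ⟨c₁, c₂, fun d hd n hn => (h d hd n hn).imp fun _ => Exists.imp fun _ =>
    And.imp_left (·.mono (by positivity))⟩
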